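/- For a complex vector space $X$ let $\mathbb{M}_n(X)$ denote the $n\times n$ matrices over $X$, and give the scalar matrices $\mathbb{M}_{n,m}(\mathbb{C})$ the operator norm $\mathbb{C}^m\to\mathbb{C}^n$ for the Euclidean norms. An operator space structure on $X$ is a sequence of norms $\mathcal{O}_n$ on $\mathbb{M}_n(X)$ such that $$\mathcal{O}_{m+n}\left(\begin{bmatrix} x&0\\0&y\end{bmatrix}\right)=\max\{\mathcal{O}_m(x),\mathcal{O}_n(y)\},\qquad \mathcal{O}_n(\alpha x\beta)\le\|\alpha\|\,\mathcal{O}_m(x)\,\|\beta\|$$ for all $x\in\mathbb{M}_m(X)$, $y\in\mathbb{M}_n(X)$, $\alpha\in\mathbb{M}_{n,m}(\mathbb{C})$, $\beta\in\mathbb{M}_{m,n}(\mathbb{C})$. A numerical radius operator space $(X,\mathcal{W}_n)$ is a complex vector space $X$ with a sequence of norms $\mathcal{W}_n$ on $\mathbb{M}_n(X)$ such that $$\mathcal{W}_{m+n}\left(\begin{bmatrix} x&0\\0&y\end{bmatrix}\right)=\max\{\mathcal{W}_m(x),\mathcal{W}_n(y)\},\qquad \mathcal{W}_n(\alpha x\alpha^*)\le\|\alpha\|^2\,\mathcal{W}_m(x)$$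 for all $x\in\mathbb{M}_m(X)$, $y\in\mathbb{M}_n(X)$, $\alpha\in\mathbb{M}_{n,m}(\mathbb{C})$. For a complex Hilbert space $\mathcal{H}$ identify $\mathbb{M}_n(\mathbb{B}(\mathcal{H}))$ with $\mathbb{B}(\mathcal{H}^n)$, where $\mathcal{H}^n$ is the Hilbert space direct sum; let $\|\cdot\|_n$ be the operator norm and $w_n(a)=\sup\{|\langle a\xi,\xi\rangle| : \xi\in\mathcal{H}^n,\ \|\xi\|=1\}$ the numerical radius on it. **Corollary 2.6.** Let $(X,\mathcal{W}_n)$ be a numerical radius operator space and put $$\mathcal{O}_n(x)=2\,\mathcal{W}_{2n}\left(\begin{bmatrix}0&x\\0&0\end{bmatrix}\right)\qquad (x\in\mathbb{M}_n(X),\ n\in\mathbb{N}).$$ Then $(\mathcal{O}_n)$ is an operator space structure on $X$. Moreover, there are a complex Hilbert space $\mathcal{H}$ and a single linear map $\varPhi:X\to\mathbb{B}(\mathcal{H})$ which is simultaneously a complete isometry for $\mathcal{O}_n$ and a $\mathcal{W}$-complete isometry for $\mathcal{W}_n$; that is, for all $n\in\mathbb{N}$ and $[x_{ij}]\in\mathbb{M}_n(X)$,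 $$\|[\varPhi(x_{ij})]\|_n=\mathcal{O}_n([x_{ij}])\quad\text{and}\quad w_n([\varPhi(x_{ij})])=\mathcal{W}_n([x_{ij}]).$$ -/

import Mathlib

universe u

/-- `N` is a norm on the complex vector space `V`. -/
structure IsNorm {V : Type*} [AddCommGroup V] [Module ℂ V] (N : V → ℝ) : Prop where
  nonneg : ∀ x, 0 ≤ N x
  add_le : ∀ x y, N (x + y) ≤ N x + N y
  smul_eq : ∀ (c : ℂ) (x : V), N (c • x) = ‖c‖ * N x
  eq_zero : ∀ x, N x = 0 → x = 0

/-- The block diagonal matrix `[[x, 0], [0, y]]` in `M_{m+n}(X)`. -/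
def blockDiag {X : Type*} [AddCommGroup X] {m n : ℕ}
    (x : Matrix (Fin m) (Fin m) X) (y : Matrix (Fin n) (Fin n) X) :
    Matrix (Fin (m + n)) (Fin (m + n)) X :=
  Matrix.reindex finSumFinEquiv finSumFinEquiv (Matrix.fromBlocks x 0 0 y)

/-- The off-diagonal matrix `[[0, x], [0, 0]]` in `M_{n+n}(X)`. -/
def offDiag {X : Type*} [AddCommGroup X] {n : ℕ} (x : Matrix (Fin n) (Fin n) X) :
    Matrix (Fin (n + n)) (Fin (n + n)) X :=
  Matrix.reindex finSumFinEquiv finSumFinEquiv (Matrix.fromBlocks 0 x 0 0)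

/-- The product `α x β` of a matrix `x` over `X` with scalar matrices `α` and `β`. -/
def scalarMulMul {X : Type*} [AddCommGroup X] [Module ℂ X] {m n : ℕ}
    (α : Matrix (Fin n) (Fin m) ℂ) (x : Matrix (Fin m) (Fin m) X)
    (β : Matrix (Fin m) (Fin n) ℂ) : Matrix (Fin n) (Fin n) X :=
  Matrix.of fun i j => ∑ k, ∑ l, (α i k * β l j) • x k l

section Axioms

open scoped Matrix Matrix.Norms.L2Operator

/-- Ruan's axioms for a sequence of matrix norms. The norm of a scalar matrix is its operator norm
as a map between Euclidean spaces. -/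
structure IsOperatorSpace {X : Type*} [AddCommGroup X] [Module ℂ X]
    (O : ∀ n : ℕ, Matrix (Fin n) (Fin n) X → ℝ) : Prop where
  isNorm : ∀ n, IsNorm (O n)
  blockDiag_eq : ∀ (m n : ℕ) (x : Matrix (Fin m) (Fin m) X) (y : Matrix (Fin n) (Fin n) X),
    O (m + n) (blockDiag x y) = max (O m x) (O n y)
  mul_mul_le : ∀ (m n : ℕ) (α : Matrix (Fin n) (Fin m) ℂ) (x : Matrix (Fin m) (Fin m) X)
    (β : Matrix (Fin m) (Fin n) ℂ), O n (scalarMulMul α x β) ≤ ‖α‖ * O m x * ‖β‖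

/-- The axioms of a numerical radius operator space for a sequence of matrix norms. -/
structure IsNumericalRadiusOperatorSpace {X : Type*} [AddCommGroup X] [Module ℂ X]
    (W : ∀ n : ℕ, Matrix (Fin n) (Fin n) X → ℝ) : Prop where
  isNorm : ∀ n, IsNorm (W n)
  blockDiag_eq : ∀ (m n : ℕ) (x : Matrix (Fin m) (Fin m) X) (y : Matrix (Fin n) (Fin n) X),
    W (m + n) (blockDiag x y) = max (W m x) (W n y)
  conj_le : ∀ (m n : ℕ) (α : Matrix (Fin n) (Fin m) ℂ) (x : Matrix (Fin m) (Fin m) X),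
    W n (scalarMulMul α x αᴴ) ≤ ‖α‖ ^ 2 * W m x

end Axioms

/-- The matrix norms `O_n(x) = 2 W_{2n}([[0, x], [0, 0]])` attached to `W`. -/
def offDiagNorm {X : Type*} [AddCommGroup X]
    (W : ∀ n : ℕ, Matrix (Fin n) (Fin n) X → ℝ) (n : ℕ) (x : Matrix (Fin n) (Fin n) X) : ℝ :=
  2 * W (n + n) (offDiag x)

section Concrete

variable {H : Type*} [NormedAddCommGroup H] [InnerProductSpace ℂ H]

/-- The numerical radius `w(T) = sup {|⟨T ξ, ξ⟩| : ‖ξ‖ = 1}` of a bounded operator. -/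
noncomputable def numericalRadius (T : H →L[ℂ] H) : ℝ :=
  sSup {r : ℝ | ∃ ξ : H, ‖ξ‖ = 1 ∧ r = ‖inner ℂ ξ (T ξ)‖}

/-- The set whose supremum is the numerical radius is bounded. -/
theorem bddAbove_numericalRadius (T : H →L[ℂ] H) :
    BddAbove {r : ℝ | ∃ ξ : H, ‖ξ‖ = 1 ∧ r = ‖inner ℂ ξ (T ξ)‖} := by
  refine ⟨‖T‖, ?_⟩
  rintro r ⟨ξ, hξ, rfl⟩
  have h1 := norm_inner_le_norm (𝕜 := ℂ) ξ (T ξ)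
  have h2 := T.le_opNorm ξ
  rw [hξ] at h1 h2
  linarith

/-- The operator on the Hilbert space direct sum `H^n` given by a matrix of operators:
`(T ξ)_i = ∑ j, T_{ij} ξ_j`. -/
noncomputable def matrixOperator {n : ℕ} (T : Matrix (Fin n) (Fin n) (H →L[ℂ] H)) :
    PiLp 2 (fun _ : Fin n => H) →L[ℂ] PiLp 2 (fun _ : Fin n => H) :=
  (PiLp.continuousLinearEquiv 2 ℂ (fun _ : Fin n => H)).symm.toContinuousLinearMap ∘L
    (ContinuousLinearMap.pi fun i => ∑ j, T i j ∘L ContinuousLinearMap.proj j) ∘L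
    (PiLp.continuousLinearEquiv 2 ℂ (fun _ : Fin n => H)).toContinuousLinearMap

theorem matrixOperator_apply {n : ℕ} (T : Matrix (Fin n) (Fin n) (H →L[ℂ] H))
    (ξ : PiLp 2 (fun _ : Fin n => H)) (i : Fin n) :
    matrixOperator T ξ i = ∑ j, T i j (ξ j) := by
  simp [matrixOperator]

/-- The operator norms on `M_n(B(H)) = B(H^n)`. -/
noncomputable def matrixOpNorm (H : Type*) [NormedAddCommGroup H] [InnerProductSpace ℂ H]
    (n : ℕ) (T : Matrix (Fin n) (Fin n) (H →L[ℂ] H)) : ℝ :=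
  ‖matrixOperator T‖

/-- The numerical radius norms on `M_n(B(H)) = B(H^n)`. -/
noncomputable def matrixNumericalRadius (H : Type*) [NormedAddCommGroup H]
    [InnerProductSpace ℂ H] (n : ℕ) (T : Matrix (Fin n) (Fin n) (H →L[ℂ] H)) : ℝ :=
  numericalRadius (matrixOperator T)

end Concrete

/-- The linear map `φ : X → Y` preserves the given matrix norms at every level. For operator space
norms this is a complete isometry, for numerical radius norms a `W`-complete isometry. -/
def IsCompletelyIsometric {X Y : Type*} [AddCommGroup X] [Module ℂ X] [AddCommGroup Y] [Module ℂ Y]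
    (N : ∀ n : ℕ, Matrix (Fin n) (Fin n) X → ℝ) (N' : ∀ n : ℕ, Matrix (Fin n) (Fin n) Y → ℝ)
    (φ : X →ₗ[ℂ] Y) : Prop :=
  ∀ (n : ℕ) (x : Matrix (Fin n) (Fin n) X), N' n (x.map φ) = N n x

/-! ### Operator norms of scalar matrices -/

section MatrixNorm

open scoped Matrix Matrix.Norms.L2Operator

variable {m n : ℕ}

/-! Every bounded `T` satisfies `‖T‖ = 2 w([[0, T], [0, 0]])` (`matrixOpNorm_eq_offDiagNorm`), so a
map preserving all numerical radius norms is also completely isometric for `offDiagNorm W`. Only a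
`W`-complete isometry has to be built; Ruan's axioms follow directly by conjugating off-diagonal
blocks with `diag(α, β*)`.

Given `x₀` and `c < W n x₀`, it suffices to find a `W`-contractive map into `B(ℂⁿ)` whose numerical
radius at `x₀` is at least `c`; the `ℓ²` sum of all these maps is the isometry. Such a map comes
from convexity. The pairs `(α x α*, h)` with `W x ≤ 1` and `αα* ≤ Re h` form a cone, and the axioms
on `W` make `t - W(x₀) s` nonnegative at its points `(s x₀, t 1)`. M. Riesz extension then yields a
functional `f` with `Re f(x₀) = W(x₀)` and a density matrix `Q` such that, for all vectors `η_k`,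
the form `∑ ⟨η_k, [f(E_ij ⊗ x_kl)] η_l⟩` is at most `W(x) ∑ ⟨η_k, Q η_k⟩` in modulus
(`exists_form_domination`).

If `Q` is replaced by `Q + ε = S*S` and `T = S⁻¹`, this bound says that `y ↦ T* [f(E_ij ⊗ y)] T` is
`W`-contractive. The vectors `S e_k` recover `f(x₀)` at total squared norm `1 + nε`. -/

theorem sum_norm_sq_mulVec_le (A : Matrix (Fin m) (Fin n) ℂ) (v : Fin n → ℂ) :
    ∑ i, ‖(A *ᵥ v) i‖ ^ 2 ≤ ‖A‖ ^ 2 * ∑ j, ‖v j‖ ^ 2 := by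
  have h := Matrix.l2_opNorm_mulVec A (WithLp.toLp 2 v)
  have h2 := pow_le_pow_left₀ (norm_nonneg _) h 2
  rw [mul_pow, EuclideanSpace.norm_sq_eq, EuclideanSpace.norm_sq_eq] at h2
  simpa using h2

theorem matrix_norm_le_of_sum_norm_sq {A : Matrix (Fin m) (Fin n) ℂ} {c : ℝ} (hc : 0 ≤ c)
    (h : ∀ v : Fin n → ℂ, ∑ i, ‖(A *ᵥ v) i‖ ^ 2 ≤ c ^ 2 * ∑ j, ‖v j‖ ^ 2) : ‖A‖ ≤ c := by
  rw [Matrix.l2_opNorm_def]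
  refine ContinuousLinearMap.opNorm_le_bound _ hc fun v => ?_
  refine le_of_sq_le_sq ?_ (by positivity)
  rw [mul_pow, EuclideanSpace.norm_sq_eq, EuclideanSpace.norm_sq_eq]
  simpa using h v

theorem matrix_norm_submatrix_one_le {σ : Fin n → Fin m} (hσ : Function.Injective σ) :
    ‖(1 : Matrix (Fin m) (Fin m) ℂ).submatrix σ id‖ ≤ 1 := by
  refine matrix_norm_le_of_sum_norm_sq zero_le_one fun v => ?_
  have : ∀ i, (((1 : Matrix (Fin m) (Fin m) ℂ).submatrix σ id) *ᵥ v) i = v (σ i) := by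
    intro i
    simp [Matrix.mulVec, dotProduct, Matrix.one_apply]
  simp only [this, one_pow, one_mul]
  rw [← Finset.sum_image (f := fun j => ‖v j‖ ^ 2) (s := Finset.univ) (g := σ)
    (fun _ _ _ _ h => hσ h)]
  exact Finset.sum_le_sum_of_subset_of_nonneg (Finset.subset_univ _) fun _ _ _ => by positivity

theorem matrix_norm_fromBlocks_diag_le {p q : ℕ} {α : Matrix (Fin m) (Fin n) ℂ}
    {β : Matrix (Fin p) (Fin q) ℂ} (hα : ‖α‖ ≤ 1) (hβ : ‖β‖ ≤ 1) :
    ‖Matrix.reindex finSumFinEquiv finSumFinEquiv (Matrix.fromBlocks α 0 0 β)‖ ≤ 1 := by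
  refine matrix_norm_le_of_sum_norm_sq zero_le_one fun v => ?_
  have e1 := sum_norm_sq_mulVec_le α (fun i => v (Fin.castAdd q i))
  have e2 := sum_norm_sq_mulVec_le β (fun i => v (Fin.natAdd n i))
  have h1 : ‖α‖ ^ 2 ≤ 1 := pow_le_one₀ (norm_nonneg _) hα
  have h2 : ‖β‖ ^ 2 ≤ 1 := pow_le_one₀ (norm_nonneg _) hβ
  have e1' := e1.trans (mul_le_of_le_one_left (Finset.sum_nonneg fun _ _ => by positivity) h1)
  have e2' := e2.trans (mul_le_of_le_one_left (Finset.sum_nonneg fun _ _ => by positivity) h2)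
  simp only [Fin.sum_univ_add, one_pow, one_mul]
  refine (le_of_eq ?_).trans (add_le_add e1' e2')
  congr 1 <;> refine Finset.sum_congr rfl fun i _ => ?_ <;>
    simp [Matrix.mulVec, dotProduct, Fin.sum_univ_add]

end MatrixNorm

/-! ### Ruan's axioms for the off-diagonal norms -/

section Abstract

open scoped Matrix Matrix.Norms.L2Operator

variable {X : Type*} [AddCommGroup X] {m n : ℕ}

/-- The permutation is the canonical shuffle exchanging the two middle blocks. -/
theorem offDiag_blockDiag (x : Matrix (Fin m) (Fin m) X) (y : Matrix (Fin n) (Fin n) X) :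
    ∃ σ : Fin (m + n + (m + n)) ≃ Fin (m + m + (n + n)),
      offDiag (blockDiag x y) = (blockDiag (offDiag x) (offDiag y)).submatrix σ σ := by
  refine ⟨finSumFinEquiv.symm.trans (((Equiv.sumCongr finSumFinEquiv.symm finSumFinEquiv.symm).trans
    (Equiv.sumSumSumComm _ _ _ _)).trans
    ((Equiv.sumCongr finSumFinEquiv finSumFinEquiv).trans finSumFinEquiv)), ?_⟩
  ext i j
  obtain ⟨i, rfl⟩ := finSumFinEquiv.surjective i
  obtain ⟨j, rfl⟩ := finSumFinEquiv.surjective j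
  rcases i with i | i <;> rcases j with j | j <;>
    obtain ⟨i, rfl⟩ := finSumFinEquiv.surjective i <;>
    obtain ⟨j, rfl⟩ := finSumFinEquiv.surjective j <;>
    rcases i with i | i <;> rcases j with j | j <;>
    simp [offDiag, blockDiag, -finSumFinEquiv_apply_left, -finSumFinEquiv_apply_right]

theorem offDiag_add (x y : Matrix (Fin n) (Fin n) X) : offDiag (x + y) = offDiag x + offDiag y := by
  ext i j
  obtain ⟨i, rfl⟩ := finSumFinEquiv.surjective i
  obtain ⟨j, rfl⟩ := finSumFinEquiv.surjective j
  rcases i with i | i <;> rcases j with j | j <;>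
    simp [offDiag, -Fin.natAdd_eq_addNat]

theorem offDiag_eq_zero {x : Matrix (Fin n) (Fin n) X} (h : offDiag x = 0) : x = 0 := by
  ext i j
  simpa [offDiag, -Fin.natAdd_eq_addNat] using
    congrFun (congrFun h (finSumFinEquiv (Sum.inl i))) (finSumFinEquiv (Sum.inr j))

theorem IsNorm.map_zero {V : Type*} [AddCommGroup V] [Module ℂ V] {N : V → ℝ} (h : IsNorm N) :
    N 0 = 0 := by
  simpa using h.smul_eq 0 0

theorem IsNorm.map_real_smul {V : Type*} [AddCommGroup V] [Module ℂ V] {N : V → ℝ}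
    (h : IsNorm N) (c : ℝ) (x : V) : N (c • x) = |c| * N x := by
  rw [← Complex.coe_smul, h.smul_eq, Complex.norm_real, Real.norm_eq_abs]

variable [Module ℂ X]

theorem scalarMulMul_smul (α : Matrix (Fin n) (Fin m) ℂ) (c : ℂ) (x : Matrix (Fin m) (Fin m) X)
    (β : Matrix (Fin m) (Fin n) ℂ) :
    scalarMulMul α (c • x) β = c • scalarMulMul α x β := by
  ext i j
  simp only [scalarMulMul, Matrix.of_apply, Matrix.smul_apply, Finset.smul_sum]
  exact Finset.sum_congr rfl fun k _ => Finset.sum_congr rfl fun l _ => smul_comm _ _ _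

theorem smul_scalarMulMul_smul (a b : ℂ) (α : Matrix (Fin n) (Fin m) ℂ)
    (x : Matrix (Fin m) (Fin m) X) (β : Matrix (Fin m) (Fin n) ℂ) :
    scalarMulMul (a • α) x (b • β) = (a * b) • scalarMulMul α x β := by
  ext i j
  simp only [scalarMulMul, Matrix.of_apply, Matrix.smul_apply, Finset.smul_sum, smul_smul,
    smul_eq_mul]
  exact Finset.sum_congr rfl fun k _ => Finset.sum_congr rfl fun l _ => by congr 1; ring

theorem scalarMulMul_submatrix_one (σ : Fin n → Fin m) (x : Matrix (Fin m) (Fin m) X) :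
    scalarMulMul ((1 : Matrix (Fin m) (Fin m) ℂ).submatrix σ id) x
      ((1 : Matrix (Fin m) (Fin m) ℂ).submatrix σ id)ᴴ = x.submatrix σ σ := by
  ext i j
  simp [scalarMulMul, Matrix.one_apply, eq_comm]

/-- In the off-diagonal corner `α` acts on the left and `β` on the right independently, so one
conjugation realizes a two-sided product. -/
theorem offDiag_scalarMulMul (α : Matrix (Fin n) (Fin m) ℂ) (x : Matrix (Fin m) (Fin m) X)
    (β : Matrix (Fin m) (Fin n) ℂ) :
    offDiag (scalarMulMul α x β) =
      scalarMulMul (Matrix.reindex finSumFinEquiv finSumFinEquiv (Matrix.fromBlocks α 0 0 βᴴ))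
        (offDiag x)
        (Matrix.reindex finSumFinEquiv finSumFinEquiv (Matrix.fromBlocks α 0 0 βᴴ))ᴴ := by
  ext i j
  obtain ⟨i, rfl⟩ := finSumFinEquiv.surjective i
  obtain ⟨j, rfl⟩ := finSumFinEquiv.surjective j
  rcases i with i | i <;> rcases j with j | j <;>
    simp [scalarMulMul, offDiag, Fin.sum_univ_add, -Fin.natAdd_eq_addNat]

variable {W : ∀ n : ℕ, Matrix (Fin n) (Fin n) X → ℝ}

theorem IsNumericalRadiusOperatorSpace.submatrix_le (hW : IsNumericalRadiusOperatorSpace W)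
    {σ : Fin n → Fin m} (hσ : Function.Injective σ) (x : Matrix (Fin m) (Fin m) X) :
    W n (x.submatrix σ σ) ≤ W m x := by
  rw [← scalarMulMul_submatrix_one]
  refine (hW.conj_le _ _ _ _).trans (mul_le_of_le_one_left ((hW.isNorm m).nonneg x) ?_)
  exact pow_le_one₀ (norm_nonneg _) (matrix_norm_submatrix_one_le hσ)

/-- Reindexing is conjugation by a contractive selection matrix, and so is its inverse. -/
theorem IsNumericalRadiusOperatorSpace.submatrix_equiv (hW : IsNumericalRadiusOperatorSpace W)
    (σ : Fin n ≃ Fin m) (x : Matrix (Fin m) (Fin m) X) :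
    W n (x.submatrix σ σ) = W m x := by
  refine le_antisymm (hW.submatrix_le σ.injective x) ?_
  simpa [Matrix.submatrix_submatrix] using hW.submatrix_le σ.symm.injective (x.submatrix σ σ)

theorem offDiag_smul (c : ℂ) (x : Matrix (Fin n) (Fin n) X) : offDiag (c • x) = c • offDiag x := by
  ext i j
  obtain ⟨i, rfl⟩ := finSumFinEquiv.surjective i
  obtain ⟨j, rfl⟩ := finSumFinEquiv.surjective j
  rcases i with i | i <;> rcases j with j | j <;>
    simp [offDiag, -Fin.natAdd_eq_addNat]

theorem offDiag_map {Y : Type*} [AddCommGroup Y] [Module ℂ Y] (φ : X →ₗ[ℂ] Y)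
    (x : Matrix (Fin n) (Fin n) X) : offDiag (x.map φ) = (offDiag x).map φ := by
  ext i j
  obtain ⟨i, rfl⟩ := finSumFinEquiv.surjective i
  obtain ⟨j, rfl⟩ := finSumFinEquiv.surjective j
  rcases i with i | i <;> rcases j with j | j <;>
    simp [offDiag, -Fin.natAdd_eq_addNat]

theorem isNorm_offDiagNorm (hW : IsNumericalRadiusOperatorSpace W) (n : ℕ) :
    IsNorm (offDiagNorm W n) where
  nonneg x := mul_nonneg zero_le_two ((hW.isNorm _).nonneg _)
  add_le x y := by
    have := (hW.isNorm _).add_le (offDiag x) (offDiag y)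
    simp only [offDiagNorm, offDiag_add]
    linarith
  smul_eq c x := by
    simp only [offDiagNorm, offDiag_smul, (hW.isNorm _).smul_eq]
    ring
  eq_zero x h := offDiag_eq_zero ((hW.isNorm _).eq_zero _ (by simpa [offDiagNorm] using h))

theorem offDiagNorm_scalarMulMul_le_of_norm_le_one (hW : IsNumericalRadiusOperatorSpace W)
    {α : Matrix (Fin n) (Fin m) ℂ} {β : Matrix (Fin m) (Fin n) ℂ} (hα : ‖α‖ ≤ 1) (hβ : ‖β‖ ≤ 1)
    (x : Matrix (Fin m) (Fin m) X) :
    offDiagNorm W n (scalarMulMul α x β) ≤ offDiagNorm W m x := by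
  simp only [offDiagNorm, offDiag_scalarMulMul]
  refine mul_le_mul_of_nonneg_left ?_ zero_le_two
  refine (hW.conj_le _ _ _ _).trans (mul_le_of_le_one_left ((hW.isNorm _).nonneg _) ?_)
  refine pow_le_one₀ (norm_nonneg _) (matrix_norm_fromBlocks_diag_le hα ?_)
  rwa [Matrix.l2_opNorm_conjTranspose]

theorem isOperatorSpace_offDiagNorm (hW : IsNumericalRadiusOperatorSpace W) :
    IsOperatorSpace (offDiagNorm W) where
  isNorm := isNorm_offDiagNorm hW
  blockDiag_eq m n x y := by
    obtain ⟨σ, hσ⟩ := offDiag_blockDiag x y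
    rw [offDiagNorm, hσ, hW.submatrix_equiv, hW.blockDiag_eq, mul_max_of_nonneg _ _ zero_le_two]
    rfl
  mul_mul_le m n α x β := by
    -- Conjugation by `diag(α, β*)` only costs `max(‖α‖, ‖β‖)²`; normalizing both factors first
    -- gives the product `‖α‖ ‖β‖`.
    have key : ∀ {p q : ℕ} (A : Matrix (Fin p) (Fin q) ℂ),
        ∃ B : Matrix (Fin p) (Fin q) ℂ, ‖B‖ ≤ 1 ∧ A = (‖A‖ : ℂ) • B := by
      intro p q A
      by_cases hA : ‖A‖ = 0
      · exact ⟨0, by simp, by simpa using hA⟩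
      · refine ⟨((‖A‖ : ℂ))⁻¹ • A, ?_, ?_⟩
        · rw [norm_smul, norm_inv, Complex.norm_real, norm_norm, inv_mul_cancel₀ hA]
        · rw [smul_smul, mul_inv_cancel₀ (by exact_mod_cast hA), one_smul]
    obtain ⟨a, ha, ha'⟩ := key α
    obtain ⟨b, hb, hb'⟩ := key β
    have h := offDiagNorm_scalarMulMul_le_of_norm_le_one hW ha hb x
    calc offDiagNorm W n (scalarMulMul α x β)
        = offDiagNorm W n (scalarMulMul ((‖α‖ : ℂ) • a) x ((‖β‖ : ℂ) • b)) := by rw [← ha', ← hb']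
      _ = ‖α‖ * ‖β‖ * offDiagNorm W n (scalarMulMul a x b) := by
        rw [smul_scalarMulMul_smul, (isNorm_offDiagNorm hW n).smul_eq]
        simp
      _ ≤ ‖α‖ * ‖β‖ * offDiagNorm W m x := mul_le_mul_of_nonneg_left h (by positivity)
      _ = _ := by ring

end Abstract

/-! ### Numerical radius and operator norm on `B(Hⁿ)` -/

section Concrete

variable {H : Type*} [NormedAddCommGroup H] [InnerProductSpace ℂ H]

theorem numericalRadius_nonneg (T : H →L[ℂ] H) : 0 ≤ numericalRadius T := by
  refine Real.sSup_nonneg ?_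
  rintro r ⟨ξ, -, rfl⟩
  exact norm_nonneg _

theorem numericalRadius_le {T : H →L[ℂ] H} {c : ℝ} (hc : 0 ≤ c)
    (h : ∀ ξ, ‖inner ℂ ξ (T ξ)‖ ≤ c * ‖ξ‖ ^ 2) : numericalRadius T ≤ c := by
  refine Real.sSup_le ?_ hc
  rintro r ⟨ξ, hξ, rfl⟩
  simpa [hξ] using h ξ

theorem norm_inner_self_apply_le (T : H →L[ℂ] H) (ξ : H) :
    ‖inner ℂ ξ (T ξ)‖ ≤ numericalRadius T * ‖ξ‖ ^ 2 := by
  by_cases hξ : ξ = 0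
  · simp [hξ]
  have hn : ‖ξ‖ ≠ 0 := norm_ne_zero_iff.mpr hξ
  have h : ‖inner ℂ ((‖ξ‖ : ℂ)⁻¹ • ξ) (T ((‖ξ‖ : ℂ)⁻¹ • ξ))‖ ≤ numericalRadius T :=
    le_csSup (bddAbove_numericalRadius T) ⟨_, by simp [norm_smul, hn], rfl⟩
  rw [map_smul, inner_smul_left, inner_smul_right] at h
  simp only [norm_mul, RCLike.norm_conj, norm_inv, Complex.norm_real, norm_norm] at h
  calc ‖inner ℂ ξ (T ξ)‖
      = (‖ξ‖⁻¹ * (‖ξ‖⁻¹ * ‖inner ℂ ξ (T ξ)‖)) * ‖ξ‖ ^ 2 := by field_simp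
    _ ≤ _ := mul_le_mul_of_nonneg_right h (by positivity)

variable {n : ℕ}

theorem inner_matrixOperator (T : Matrix (Fin n) (Fin n) (H →L[ℂ] H))
    (u v : PiLp 2 (fun _ : Fin n => H)) :
    inner ℂ u (matrixOperator T v) = ∑ k, ∑ l, inner ℂ (u k) (T k l (v l)) := by
  simp [PiLp.inner_apply, matrixOperator_apply, inner_sum]

theorem norm_inner_le_matrixNumericalRadius (T : Matrix (Fin n) (Fin n) (H →L[ℂ] H))
    (ξ : Fin n → H) :
    ‖∑ k, ∑ l, inner ℂ (ξ k) (T k l (ξ l))‖ ≤ matrixNumericalRadius H n T * ∑ k, ‖ξ k‖ ^ 2 := by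
  have := norm_inner_self_apply_le (matrixOperator T) (WithLp.toLp 2 ξ)
  rwa [inner_matrixOperator, PiLp.norm_sq_eq_of_L2] at this

theorem matrixNumericalRadius_le {T : Matrix (Fin n) (Fin n) (H →L[ℂ] H)} {c : ℝ} (hc : 0 ≤ c)
    (h : ∀ ξ : Fin n → H,
      ‖∑ k, ∑ l, inner ℂ (ξ k) (T k l (ξ l))‖ ≤ c * ∑ k, ‖ξ k‖ ^ 2) :
    matrixNumericalRadius H n T ≤ c := by
  refine numericalRadius_le hc fun ξ => ?_
  rw [inner_matrixOperator, PiLp.norm_sq_eq_of_L2]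
  exact h ξ

theorem inner_offDiag (T : Matrix (Fin n) (Fin n) (H →L[ℂ] H)) (ξ : Fin (n + n) → H) :
    ∑ k, ∑ l, inner ℂ (ξ k) (offDiag T k l (ξ l)) =
      inner ℂ (WithLp.toLp 2 fun k => ξ (Fin.castAdd n k))
        (matrixOperator T (WithLp.toLp 2 fun k => ξ (Fin.natAdd n k))) := by
  rw [inner_matrixOperator]
  simp [Fin.sum_univ_add, offDiag, -Fin.natAdd_eq_addNat]

/-- The operator norm is twice the numerical radius of the off-diagonal dilation. -/
theorem matrixOpNorm_eq_offDiagNorm (T : Matrix (Fin n) (Fin n) (H →L[ℂ] H)) :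
    matrixOpNorm H n T = offDiagNorm (matrixNumericalRadius H) n T := by
  apply le_antisymm
  · have hw : 0 ≤ matrixNumericalRadius H (n + n) (offDiag T) := numericalRadius_nonneg _
    have key : ∀ u v : PiLp 2 (fun _ : Fin n => H), ‖inner ℂ u (matrixOperator T v)‖ ≤
        matrixNumericalRadius H (n + n) (offDiag T) * (‖u‖ ^ 2 + ‖v‖ ^ 2) := by
      intro u v
      have h := norm_inner_le_matrixNumericalRadius (offDiag T) (Fin.append u v)
      rw [inner_offDiag, Fin.sum_univ_add] at h
      simp only [Fin.append_left, Fin.append_right] at h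
      rwa [PiLp.norm_sq_eq_of_L2, PiLp.norm_sq_eq_of_L2]
    refine ContinuousLinearMap.opNorm_le_bound _ (mul_nonneg zero_le_two hw) fun v => ?_
    set w := matrixNumericalRadius H (n + n) (offDiag T)
    set z := matrixOperator T v with hz
    by_cases hz0 : ‖z‖ = 0
    · rw [hz0]
      exact mul_nonneg (mul_nonneg zero_le_two hw) (norm_nonneg _)
    by_cases hv0 : ‖v‖ = 0
    · rw [hz, norm_eq_zero.mp hv0]; simp
    -- Rescaling `z` to length `‖v‖` makes `2‖u‖‖v‖ ≤ ‖u‖² + ‖v‖²` an equality, so nothing is lost.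
    have h := key (((‖v‖ / ‖z‖ : ℝ) : ℂ) • z) v
    rw [← hz, inner_smul_left, inner_self_eq_norm_sq_to_K, norm_smul] at h
    simp only [norm_mul, RCLike.norm_conj, Complex.norm_real, norm_div, norm_norm, norm_pow,
      Complex.coe_algebraMap] at h
    rw [div_mul_cancel₀ _ hz0, pow_two, pow_two, ← mul_assoc, div_mul_cancel₀ _ hz0] at h
    have hv : 0 < ‖v‖ := lt_of_le_of_ne (norm_nonneg _) (Ne.symm hv0)
    refine le_of_mul_le_mul_left ?_ hv
    change _ ≤ ‖v‖ * (2 * w * ‖v‖)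
    linarith
  · have h : matrixNumericalRadius H (n + n) (offDiag T) ≤ matrixOpNorm H n T / 2 := by
      have h0 : 0 ≤ matrixOpNorm H n T := norm_nonneg (matrixOperator T)
      refine matrixNumericalRadius_le (by positivity) fun ξ => ?_
      rw [inner_offDiag, Fin.sum_univ_add]
      set u : PiLp 2 (fun _ : Fin n => H) := WithLp.toLp 2 fun k => ξ (Fin.castAdd n k)
      set v : PiLp 2 (fun _ : Fin n => H) := WithLp.toLp 2 fun k => ξ (Fin.natAdd n k)
      have hu : ∑ k, ‖ξ (Fin.castAdd n k)‖ ^ 2 = ‖u‖ ^ 2 := by rw [PiLp.norm_sq_eq_of_L2]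
      have hv : ∑ k, ‖ξ (Fin.natAdd n k)‖ ^ 2 = ‖v‖ ^ 2 := by rw [PiLp.norm_sq_eq_of_L2]
      rw [hu, hv]
      have h1 := norm_inner_le_norm (𝕜 := ℂ) u (matrixOperator T v)
      have h2 : ‖matrixOperator T v‖ ≤ matrixOpNorm H n T * ‖v‖ :=
        (matrixOperator T).le_opNorm v
      have h3 := mul_le_mul_of_nonneg_left h2 (norm_nonneg u)
      nlinarith [mul_nonneg h0 (sq_nonneg (‖u‖ - ‖v‖))]
    rw [offDiagNorm]
    linarith

theorem opNorm_le_matrixOpNorm (T : Matrix (Fin n) (Fin n) (H →L[ℂ] H)) (i j : Fin n) :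
    ‖T i j‖ ≤ matrixOpNorm H n T := by
  refine ContinuousLinearMap.opNorm_le_bound _ (norm_nonneg (matrixOperator T)) fun v => ?_
  have h := (matrixOperator T).le_opNorm (WithLp.toLp 2 (Pi.single j v))
  have h2 : T i j v = matrixOperator T (WithLp.toLp 2 (Pi.single j v)) i := by
    rw [matrixOperator_apply, Finset.sum_eq_single j]
    · simp
    · intro k _ hk
      simp [Pi.single_eq_of_ne hk]
    · simp
  rw [h2]
  refine (PiLp.norm_apply_le _ _).trans (h.trans ?_)
  simp [matrixOpNorm]

/-- A map that preserves numerical radius norms is completely isometric for the associated operator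
space norms. -/
theorem IsCompletelyIsometric.offDiagNorm {X : Type*} [AddCommGroup X] [Module ℂ X]
    {W : ∀ n : ℕ, Matrix (Fin n) (Fin n) X → ℝ} {Φ : X →ₗ[ℂ] (H →L[ℂ] H)}
    (h : IsCompletelyIsometric W (matrixNumericalRadius H) Φ) :
    IsCompletelyIsometric (offDiagNorm W) (matrixOpNorm H) Φ := by
  intro n x
  rw [matrixOpNorm_eq_offDiagNorm, _root_.offDiagNorm, offDiag_map, h, _root_.offDiagNorm]

end Concrete

/-! ### Direct sums of representations -/

section DirectSum

variable {X : Type*} [AddCommGroup X] [Module ℂ X] {ι : Type*} {G : ι → Type*}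
  [∀ i, NormedAddCommGroup (G i)] [∀ i, InnerProductSpace ℂ (G i)]

/-- The direct sum of a pointwise bounded family of linear maps into `B(G i)`. -/
noncomputable def lpDirectSum (Φ : ∀ i, X →ₗ[ℂ] (G i →L[ℂ] G i)) (c : X → ℝ)
    (hc : ∀ y, 0 ≤ c y) (hΦ : ∀ i y, ‖Φ i y‖ ≤ c y) : X →ₗ[ℂ] (lp G 2 →L[ℂ] lp G 2) where
  toFun y := lp.mapCLM 2 (fun i => Φ i y) (hc y) fun i => hΦ i y
  map_add' y z := by
    ext f i
    simp
  map_smul' a y := by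
    ext f i
    simp

theorem lpDirectSum_apply (Φ : ∀ i, X →ₗ[ℂ] (G i →L[ℂ] G i)) (c : X → ℝ)
    (hc : ∀ y, 0 ≤ c y) (hΦ : ∀ i y, ‖Φ i y‖ ≤ c y) (y : X) (f : lp G 2) (i : ι) :
    lpDirectSum Φ c hc hΦ y f i = Φ i y (f i) := by
  simp [lpDirectSum]

/-- The form of a direct sum is the sum of the forms of its summands, so its numerical radius is the
supremum of theirs. -/
theorem exists_isCompletelyIsometric_lp {W : ∀ n : ℕ, Matrix (Fin n) (Fin n) X → ℝ}
    (hW0 : ∀ n x, 0 ≤ W n x) (Φ : ∀ i, X →ₗ[ℂ] (G i →L[ℂ] G i))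
    (hle : ∀ i n x, matrixNumericalRadius (G i) n (x.map (Φ i)) ≤ W n x)
    (hge : ∀ n x, ∀ c < W n x, ∃ i, c ≤ matrixNumericalRadius (G i) n (x.map (Φ i))) :
    ∃ Ψ : X →ₗ[ℂ] (lp G 2 →L[ℂ] lp G 2),
      IsCompletelyIsometric W (matrixNumericalRadius (lp G 2)) Ψ := by
  classical
  have hc : ∀ y : X, 0 ≤ offDiagNorm W 1 (Matrix.of fun _ _ => y) :=
    fun y => mul_nonneg zero_le_two (hW0 _ _)
  -- Contractivity at the off-diagonal `2 × 2` level bounds the operator norms uniformly in `i`, so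
  -- the direct sum consists of bounded operators.
  have hΦ : ∀ i y, ‖Φ i y‖ ≤ offDiagNorm W 1 (Matrix.of fun _ _ => y) := by
    intro i y
    refine (opNorm_le_matrixOpNorm ((Matrix.of fun _ _ => y : Matrix (Fin 1) (Fin 1) X).map (Φ i))
      0 0).trans ?_
    rw [matrixOpNorm_eq_offDiagNorm, offDiagNorm, offDiag_map]
    exact mul_le_mul_of_nonneg_left (hle _ _ _) zero_le_two
  refine ⟨lpDirectSum Φ _ hc hΦ, fun n x => le_antisymm ?_ ?_⟩
  · refine matrixNumericalRadius_le (hW0 n x) fun ξ => ?_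
    have h1 : HasSum (fun i => ∑ k, ∑ l, inner ℂ (ξ k i) (Φ i (x k l) (ξ l i)))
        (∑ k, ∑ l, inner ℂ (ξ k) ((x.map (lpDirectSum Φ _ hc hΦ)) k l (ξ l))) := by
      refine hasSum_sum fun k _ => hasSum_sum fun l _ => ?_
      simpa only [Matrix.map_apply, lpDirectSum_apply] using
        lp.hasSum_inner (𝕜 := ℂ) (ξ k) ((x.map (lpDirectSum Φ _ hc hΦ)) k l (ξ l))
    have h2 : HasSum (fun i => W n x * ∑ k, ‖ξ k i‖ ^ 2) (W n x * ∑ k, ‖ξ k‖ ^ 2) := by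
      refine (hasSum_sum fun k _ => ?_).mul_left _
      simpa using lp.hasSum_norm (p := 2) (by simp) (ξ k)
    refine h1.norm_le_of_bounded h2 fun i => ?_
    refine (norm_inner_le_matrixNumericalRadius (x.map (Φ i)) fun k => ξ k i).trans ?_
    exact mul_le_mul_of_nonneg_right (hle i n x) (Finset.sum_nonneg fun _ _ => by positivity)
  · refine le_of_forall_lt fun c hc' => ?_
    obtain ⟨d, hcd, hd⟩ := exists_between hc'
    obtain ⟨i, hi⟩ := hge n x d hd
    refine hcd.trans_le (hi.trans ?_)
    -- Vectors supported in the `i`-th summand see only `Φ i`.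
    refine matrixNumericalRadius_le (numericalRadius_nonneg _) fun η => ?_
    have h := norm_inner_le_matrixNumericalRadius (x.map (lpDirectSum Φ _ hc hΦ))
      fun k => lp.single 2 i (η k)
    simpa [lp.inner_single_left, lpDirectSum_apply, lp.norm_single] using h

end DirectSum

/-- The M. Riesz extension theorem for a functional given on the range of an injective linear map. -/
theorem exists_nonneg_extension {E D : Type*} [AddCommGroup E] [Module ℝ E] [AddCommGroup D]
    [Module ℝ D] (s : PointedCone ℝ E) (i : D →ₗ[ℝ] E) (hi : Function.Injective i)
    (φ : D →ₗ[ℝ] ℝ) (nonneg : ∀ d, i d ∈ s → 0 ≤ φ d) (dense : ∀ y, ∃ d, i d + y ∈ s) :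
    ∃ g : E →ₗ[ℝ] ℝ, (∀ d, g (i d) = φ d) ∧ ∀ x ∈ s, 0 ≤ g x := by
  let e := LinearEquiv.ofInjective i hi
  obtain ⟨g, hg, hs⟩ := riesz_extension s ⟨LinearMap.range i, φ ∘ₗ e.symm.toLinearMap⟩
    (fun x hx => nonneg _ (by
      have : i (e.symm x) = x := congrArg Subtype.val (e.apply_symm_apply x)
      simpa [this] using hx))
    (fun y => by
      obtain ⟨d, hd⟩ := dense y
      exact ⟨e d, hd⟩)
  refine ⟨g, fun d => ?_, hs⟩
  have := hg (e d)
  simpa [e] using this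

/-! ### The cone and its separating functional -/

section Cone

open scoped Matrix Matrix.Norms.L2Operator

variable {X : Type*} [AddCommGroup X] [Module ℂ X] {m n : ℕ}

/-- Conjugation by the row `[α β]` absorbs a sum into one term; with the maximum rule for diagonal
blocks, this closes the cone under addition. -/
theorem scalarMulMul_append (α : Matrix (Fin n) (Fin m) ℂ) {p : ℕ} (β : Matrix (Fin n) (Fin p) ℂ)
    (x : Matrix (Fin m) (Fin m) X) (y : Matrix (Fin p) (Fin p) X) :
    scalarMulMul (Matrix.of fun i => Fin.append (α i) (β i)) (blockDiag x y)
        (Matrix.of fun i => Fin.append (α i) (β i))ᴴ =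
      scalarMulMul α x αᴴ + scalarMulMul β y βᴴ := by
  ext i j
  simp [scalarMulMul, blockDiag, Fin.sum_univ_add, -Fin.natAdd_eq_addNat]

theorem sum_norm_sq_conjTranspose_append_mulVec (α : Matrix (Fin n) (Fin m) ℂ) {p : ℕ}
    (β : Matrix (Fin n) (Fin p) ℂ) (v : Fin n → ℂ) :
    ∑ k, ‖((Matrix.of fun i => Fin.append (α i) (β i))ᴴ *ᵥ v) k‖ ^ 2 =
      ∑ k, ‖(αᴴ *ᵥ v) k‖ ^ 2 + ∑ k, ‖(βᴴ *ᵥ v) k‖ ^ 2 := by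
  simp [Fin.sum_univ_add, Matrix.mulVec, dotProduct, -Fin.natAdd_eq_addNat]

theorem abs_re_dotProduct_mulVec_le (h : Matrix (Fin n) (Fin n) ℂ) (v : Fin n → ℂ) :
    |(star v ⬝ᵥ h *ᵥ v).re| ≤ ‖h‖ * ∑ i, ‖v i‖ ^ 2 := by
  have h1 := norm_inner_le_norm (𝕜 := ℂ) (WithLp.toLp 2 v) (WithLp.toLp 2 (h *ᵥ v))
  have h2 := Matrix.l2_opNorm_mulVec h (WithLp.toLp 2 v)
  have h3 : inner ℂ (WithLp.toLp 2 v) (WithLp.toLp 2 (h *ᵥ v)) = star v ⬝ᵥ h *ᵥ v := by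
    rw [EuclideanSpace.inner_toLp_toLp, dotProduct_comm]
  rw [h3] at h1
  have h4 : ∑ i, ‖v i‖ ^ 2 = ‖WithLp.toLp 2 v‖ ^ 2 := by rw [EuclideanSpace.norm_sq_eq]
  rw [h4]
  refine (Complex.abs_re_le_norm _).trans (h1.trans ?_)
  have := mul_le_mul_of_nonneg_left h2 (norm_nonneg (WithLp.toLp 2 v))
  refine this.trans (le_of_eq ?_)
  ring

/-- The cone of pairs `(α x α*, h)` with `W x ≤ 1` and `α α*` below the real part of `h`. -/
def conjCone {W : ∀ n : ℕ, Matrix (Fin n) (Fin n) X → ℝ}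
    (hW : IsNumericalRadiusOperatorSpace W) (n : ℕ) :
    PointedCone ℝ (Matrix (Fin n) (Fin n) X × Matrix (Fin n) (Fin n) ℂ) where
  carrier := {z | ∃ (m : ℕ) (α : Matrix (Fin n) (Fin m) ℂ) (x : Matrix (Fin m) (Fin m) X),
    W m x ≤ 1 ∧ z.1 = scalarMulMul α x αᴴ ∧
      ∀ v, ∑ k, ‖(αᴴ *ᵥ v) k‖ ^ 2 ≤ (star v ⬝ᵥ z.2 *ᵥ v).re}
  zero_mem' := ⟨0, 0, 0, by simp [(hW.isNorm 0).map_zero], by ext; simp [scalarMulMul], by simp⟩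
  add_mem' := by
    rintro ⟨y, h⟩ ⟨y', h'⟩ ⟨m, α, x, hx, rfl, hα⟩ ⟨p, β, x', hx', rfl, hβ⟩
    refine ⟨m + p, Matrix.of fun i => Fin.append (α i) (β i), blockDiag x x', ?_, ?_, fun v => ?_⟩
    · rw [hW.blockDiag_eq]
      exact max_le hx hx'
    · exact (scalarMulMul_append α β x x').symm
    · rw [sum_norm_sq_conjTranspose_append_mulVec]
      simpa [Matrix.add_mulVec] using add_le_add (hα v) (hβ v)
  smul_mem' := by
    rintro ⟨c, hc⟩ ⟨y, h⟩ ⟨m, α, x, hx, rfl, hα⟩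
    refine ⟨m, ((√c : ℝ) : ℂ) • α, x, hx, ?_, fun v => ?_⟩
    · rw [Matrix.conjTranspose_smul, smul_scalarMulMul_smul]
      have : ((√c : ℝ) : ℂ) * star ((√c : ℝ) : ℂ) = (c : ℂ) := by
        rw [Complex.star_def, Complex.conj_ofReal, ← Complex.ofReal_mul, Real.mul_self_sqrt hc]
      rw [this, Complex.coe_smul]
      rfl
    · have h1 := mul_le_mul_of_nonneg_left (hα v) hc
      have h2 : ((⟨c, hc⟩ : {c : ℝ // 0 ≤ c}) • h) = (c : ℂ) • h := by
        rw [Complex.coe_smul]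
        rfl
      have h3 : (star v ⬝ᵥ ((c : ℂ) • h) *ᵥ v).re = c * (star v ⬝ᵥ h *ᵥ v).re := by
        rw [Matrix.smul_mulVec, dotProduct_smul, smul_eq_mul, Complex.re_ofReal_mul]
      change _ ≤ (star v ⬝ᵥ ((⟨c, hc⟩ : {c : ℝ // 0 ≤ c}) • h) *ᵥ v).re
      rw [h2, h3]
      refine le_trans (le_of_eq ?_) h1
      rw [Finset.mul_sum]
      refine Finset.sum_congr rfl fun k _ => ?_
      rw [Matrix.conjTranspose_smul, Matrix.smul_mulVec, Pi.smul_apply, norm_smul, mul_pow]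
      simp [abs_of_nonneg (Real.sqrt_nonneg c), Real.sq_sqrt hc]

variable {W : ∀ n : ℕ, Matrix (Fin n) (Fin n) X → ℝ}

theorem re_dotProduct_real_smul_one (t : ℝ) (v : Fin n → ℂ) :
    (star v ⬝ᵥ (t • (1 : Matrix (Fin n) (Fin n) ℂ)) *ᵥ v).re = t * ∑ i, ‖v i‖ ^ 2 := by
  rw [Matrix.smul_mulVec, Matrix.one_mulVec, dotProduct_smul, Complex.smul_re, smul_eq_mul]
  congr 1
  simp only [dotProduct, Complex.re_sum, Pi.star_apply, Complex.star_def]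
  refine Finset.sum_congr rfl fun i _ => ?_
  rw [← Complex.normSq_eq_conj_mul_self, Complex.ofReal_re, Complex.normSq_eq_norm_sq]

theorem exists_separating_functional (hW : IsNumericalRadiusOperatorSpace W)
    {x₀ : Matrix (Fin n) (Fin n) X} (hx₀ : x₀ ≠ 0) :
    ∃ g : (Matrix (Fin n) (Fin n) X × Matrix (Fin n) (Fin n) ℂ) →ₗ[ℝ] ℝ,
      g (x₀, 0) = -W n x₀ ∧ g (0, 1) = 1 ∧ ∀ z ∈ conjCone hW n, 0 ≤ g z := by
  -- A nonzero `x₀` forces `n > 0`, so `1 ≠ 0` and there is a basis vector to test positivity on.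
  obtain ⟨i₀, -⟩ : ∃ i, x₀ i ≠ 0 := Function.ne_iff.mp hx₀
  have h1 : (1 : Matrix (Fin n) (Fin n) ℂ) ≠ 0 := by
    intro h
    simpa using congrFun (congrFun h i₀) i₀
  let i : ℝ × ℝ →ₗ[ℝ] Matrix (Fin n) (Fin n) X × Matrix (Fin n) (Fin n) ℂ :=
    (LinearMap.toSpanSingleton ℝ _ x₀).prodMap (LinearMap.toSpanSingleton ℝ _ 1)
  have hi : ∀ s t : ℝ, i (s, t) = (s • x₀, t • 1) := fun s t => rfl
  let φ : ℝ × ℝ →ₗ[ℝ] ℝ := LinearMap.snd ℝ ℝ ℝ - W n x₀ • LinearMap.fst ℝ ℝ ℝ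
  have hφ : ∀ s t : ℝ, φ (s, t) = t - W n x₀ * s := fun s t => rfl
  have hinj : Function.Injective i := by
    rw [injective_iff_map_eq_zero]
    rintro ⟨s, t⟩ h
    rw [hi, Prod.mk_eq_zero, smul_eq_zero, smul_eq_zero] at h
    simpa [hx₀, h1] using h
  have hnonneg : ∀ d, i d ∈ conjCone hW n → 0 ≤ φ d := by
    rintro ⟨s, t⟩ h
    rw [hi] at h
    obtain ⟨m, α, x, hx, hsx, hα⟩ := h
    simp only [re_dotProduct_real_smul_one] at hsx hα
    have ht : 0 ≤ t := by
      have h0 := hα (Pi.single i₀ 1)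
      rw [Finset.sum_eq_single i₀ (fun k _ hk => by simp [Pi.single_eq_of_ne hk])
        (by simp)] at h0
      rw [Pi.single_eq_same, norm_one, one_pow, mul_one] at h0
      exact (Finset.sum_nonneg fun _ _ => by positivity).trans h0
    -- Here `αα* ≤ t` gives `‖α‖² ≤ t`, and the conjugation axiom turns `s x₀ = α x α*` into `|s|
    -- W(x₀) ≤ t`.
    have hn : ‖α‖ ≤ √t := by
      rw [← Matrix.l2_opNorm_conjTranspose]
      refine matrix_norm_le_of_sum_norm_sq (Real.sqrt_nonneg t) fun v => ?_
      rw [Real.sq_sqrt ht]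
      exact hα v
    have hn2 : ‖α‖ ^ 2 ≤ t := (Real.le_sqrt (norm_nonneg _) ht).mp hn
    have h2 : |s| * W n x₀ ≤ t := by
      rw [← (hW.isNorm n).map_real_smul, hsx]
      refine (hW.conj_le _ _ _ _).trans ?_
      calc ‖α‖ ^ 2 * W m x ≤ ‖α‖ ^ 2 * 1 := mul_le_mul_of_nonneg_left hx (by positivity)
        _ ≤ t := by rwa [mul_one]
    have h3 := mul_le_mul_of_nonneg_right (le_abs_self s) ((hW.isNorm n).nonneg x₀)
    rw [hφ]
    linarith
  have hdense : ∀ y, ∃ d, i d + y ∈ conjCone hW n := by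
    rintro ⟨y, h⟩
    have hy := (hW.isNorm n).nonneg y
    set c : ℝ := W n y + 1 with hc
    have hc0 : 0 < c := by linarith
    have hsq : ((√c : ℝ) : ℂ) * ((√c : ℝ) : ℂ) = (c : ℂ) := by
      rw [← Complex.ofReal_mul, Real.mul_self_sqrt hc0.le]
    have hαH : (((√c : ℝ) : ℂ) • (1 : Matrix (Fin n) (Fin n) ℂ))ᴴ = ((√c : ℝ) : ℂ) • 1 := by
      rw [Matrix.conjTranspose_smul, Matrix.conjTranspose_one, Complex.star_def,
        Complex.conj_ofReal]
    -- Adding a multiple of `(0, 1)` is enough: `y = √c (c⁻¹ y) √c` uses up `c`, while `‖h‖`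
    -- compensates the real part of `h`. The `+ 1` in `c` permits division when `y = 0`.
    refine ⟨(0, c + ‖h‖), n, ((√c : ℝ) : ℂ) • 1, (c : ℂ)⁻¹ • y, ?_, ?_, fun v => ?_⟩
    · rw [(hW.isNorm n).smul_eq, norm_inv, Complex.norm_real, Real.norm_of_nonneg hc0.le,
        inv_mul_le_iff₀ hc0]
      linarith
    · rw [hαH, smul_scalarMulMul_smul, scalarMulMul_smul, smul_smul, hsq,
        mul_inv_cancel₀ (by exact_mod_cast hc0.ne'), one_smul, hi]
      have := scalarMulMul_submatrix_one (id : Fin n → Fin n) y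
      simp only [Matrix.submatrix_id_id, Matrix.conjTranspose_one] at this
      simp [this]
    · rw [hαH, hi]
      have h4 := (abs_le.mp (abs_re_dotProduct_mulVec_le h v)).1
      have h5 : (star v ⬝ᵥ ((((0 : ℝ) • x₀, (c + ‖h‖) • (1 : Matrix (Fin n) (Fin n) ℂ)) +
          (y, h)).2) *ᵥ v).re = (c + ‖h‖) * ∑ i, ‖v i‖ ^ 2 + (star v ⬝ᵥ h *ᵥ v).re := by
        rw [← re_dotProduct_real_smul_one, Prod.snd_add, Matrix.add_mulVec, dotProduct_add,
          Complex.add_re]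
      rw [h5]
      have h6 : ∑ k, ‖((((√c : ℝ) : ℂ) • (1 : Matrix (Fin n) (Fin n) ℂ)) *ᵥ v) k‖ ^ 2 =
          c * ∑ i, ‖v i‖ ^ 2 := by
        simp [Matrix.smul_mulVec, mul_pow, Finset.mul_sum, Real.sq_sqrt hc0.le]
      rw [h6]
      linarith
  obtain ⟨g, hg, hs⟩ := exists_nonneg_extension (conjCone hW n) i hinj φ hnonneg hdense
  refine ⟨g, ?_, ?_, hs⟩
  · have := hg (1, 0)
    rwa [hi, hφ, one_smul, zero_smul, mul_one, zero_sub] at this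
  · have := hg (0, 1)
    rwa [hi, hφ, one_smul, zero_smul, mul_zero, sub_zero] at this

end Cone

/-! ### Domination by a density matrix -/

section Representation

open scoped Matrix ComplexOrder

variable {X : Type*} [AddCommGroup X] [Module ℂ X] {n : ℕ}
  {W : ∀ n : ℕ, Matrix (Fin n) (Fin n) X → ℝ}

theorem star_dotProduct_mul_conjTranspose_mulVec {m : ℕ} (α : Matrix (Fin n) (Fin m) ℂ)
    (v : Fin n → ℂ) :
    star v ⬝ᵥ (α * αᴴ) *ᵥ v = ((∑ k, ‖(αᴴ *ᵥ v) k‖ ^ 2 : ℝ) : ℂ) := by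
  rw [← Matrix.mulVec_mulVec, Matrix.dotProduct_mulVec]
  have : star v ᵥ* α = star (αᴴ *ᵥ v) := by
    rw [Matrix.star_mulVec, Matrix.conjTranspose_conjTranspose]
  rw [this]
  simp [dotProduct, Complex.conj_mul']

theorem sum_sum_comm_sum_sum {ι κ M : Type*} [Fintype ι] [Fintype κ] [AddCommMonoid M]
    (F : ι → ι → κ → κ → M) :
    ∑ i, ∑ j, ∑ k, ∑ l, F i j k l = ∑ k, ∑ l, ∑ i, ∑ j, F i j k l := by
  simpa only [Fintype.sum_prod_type] using
    Finset.sum_comm (s := (Finset.univ : Finset (ι × ι))) (t := (Finset.univ : Finset (κ × κ)))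
      (f := fun p q => F p.1 p.2 q.1 q.2)

theorem map_eq_sum_single (f : Matrix (Fin n) (Fin n) X →ₗ[ℂ] ℂ) (y : Matrix (Fin n) (Fin n) X) :
    f y = ∑ i, ∑ j, f (Matrix.single i j (y i j)) := by
  conv_lhs => rw [Matrix.matrix_eq_sum_single y]
  simp only [map_sum]

/-- With the conjugates of the `η k` as columns of `α`, evaluating `f` on `α x α*` becomes a form in
the `η k`. -/
theorem map_scalarMulMul_conj {m : ℕ} (f : Matrix (Fin n) (Fin n) X →ₗ[ℂ] ℂ)
    (η : Fin m → Fin n → ℂ) (x : Matrix (Fin m) (Fin m) X) :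
    f (scalarMulMul (Matrix.of fun i k => star (η k i)) x
        (Matrix.of fun i k => star (η k i))ᴴ) =
      ∑ k, ∑ l, star (η k) ⬝ᵥ (Matrix.of fun i j => f (Matrix.single i j (x k l))) *ᵥ η l := by
  have hs : ∀ (i j : Fin n) (c : ℂ) (y : X),
      f (Matrix.single i j (c • y)) = c * f (Matrix.single i j y) := by
    intro i j c y
    rw [← Matrix.smul_single, map_smul, smul_eq_mul]
  have ha : ∀ (i j : Fin n) (F : Fin m → X),
      f (Matrix.single i j (∑ k, F k)) = ∑ k, f (Matrix.single i j (F k)) := by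
    intro i j F
    rw [← map_sum, ← Matrix.singleAddMonoidHom_apply, map_sum]
    simp
  rw [map_eq_sum_single]
  simp only [scalarMulMul, Matrix.of_apply, ha, hs, Matrix.conjTranspose_apply, star_star,
    dotProduct, Matrix.mulVec, Finset.mul_sum, Pi.star_apply]
  rw [sum_sum_comm_sum_sum]
  refine Finset.sum_congr rfl fun k _ => Finset.sum_congr rfl fun l _ =>
    Finset.sum_congr rfl fun i _ => Finset.sum_congr rfl fun j _ => ?_
  ring

theorem exists_form_domination (hW : IsNumericalRadiusOperatorSpace W)
    {x₀ : Matrix (Fin n) (Fin n) X} (hx₀ : x₀ ≠ 0) :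
    ∃ (f : Matrix (Fin n) (Fin n) X →ₗ[ℂ] ℂ) (Q : Matrix (Fin n) (Fin n) ℂ),
      (f x₀).re = W n x₀ ∧ Q.PosSemidef ∧ Q.trace.re = 1 ∧
      ∀ (m : ℕ) (x : Matrix (Fin m) (Fin m) X) (η : Fin m → Fin n → ℂ),
        ‖∑ k, ∑ l, star (η k) ⬝ᵥ (Matrix.of fun i j => f (Matrix.single i j (x k l))) *ᵥ η l‖ ≤
          W m x * ∑ k, (star (η k) ⬝ᵥ Q *ᵥ η k).re := by
  obtain ⟨g, hg₀, hg₁, hg⟩ := exists_separating_functional hW hx₀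
  let f : Matrix (Fin n) (Fin n) X →ₗ[ℂ] ℂ :=
    Module.Dual.extendRCLike (𝕜 := ℂ) (-(g ∘ₗ LinearMap.inl ℝ _ _))
  let p : Matrix (Fin n) (Fin n) ℂ →ₗ[ℂ] ℂ :=
    Module.Dual.extendRCLike (𝕜 := ℂ) (g ∘ₗ LinearMap.inr ℝ _ _)
  have hf : ∀ y, (f y).re = -g (y, 0) := fun y =>
    Module.Dual.re_extendRCLike_apply (𝕜 := ℂ) (-(g ∘ₗ LinearMap.inl ℝ _ _)) y
  have hp : ∀ h, (p h).re = g (0, h) := fun h =>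
    Module.Dual.re_extendRCLike_apply (𝕜 := ℂ) (g ∘ₗ LinearMap.inr ℝ _ _) h
  have hpi : ∀ h, (p h).im = -g (0, Complex.I • h) := fun h =>
    Module.Dual.im_extendRCLike_apply (𝕜 := ℂ) (g ∘ₗ LinearMap.inr ℝ _ _) h
  -- `g` sees only the Hermitian part of the second component
  have hpos : ∀ h : Matrix (Fin n) (Fin n) ℂ, (∀ v, 0 ≤ (star v ⬝ᵥ h *ᵥ v).re) → 0 ≤ g (0, h) := by
    intro h hh
    -- The empty factor `m = 0` puts `(0, h)` in the cone.
    refine hg _ ⟨0, 0, 0, by simp [(hW.isNorm 0).map_zero], ?_, fun v => by simpa using hh v⟩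
    ext
    simp [scalarMulMul]
  have hstar : ∀ (h : Matrix (Fin n) (Fin n) ℂ) (v : Fin n → ℂ),
      (star v ⬝ᵥ hᴴ *ᵥ v).re = (star v ⬝ᵥ h *ᵥ v).re := by
    intro h v
    rw [← Complex.conj_re, ← Complex.star_def, ← Matrix.star_dotProduct_star, star_star,
      Matrix.star_mulVec, Matrix.conjTranspose_conjTranspose, ← Matrix.dotProduct_mulVec]
  have hherm : ∀ h : Matrix (Fin n) (Fin n) ℂ, g (0, hᴴ) = g (0, h) := by
    intro h
    have h0 : ∀ v, (star v ⬝ᵥ (hᴴ - h) *ᵥ v).re = 0 := by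
      intro v
      rw [Matrix.sub_mulVec, dotProduct_sub, Complex.sub_re, hstar, sub_self]
    have h1 := hpos (hᴴ - h) fun v => (h0 v).ge
    have h2 := hpos (-(hᴴ - h)) fun v => by
      rw [Matrix.neg_mulVec, dotProduct_neg, Complex.neg_re, h0, neg_zero]
    have e1 : g (0, hᴴ - h) = g (0, hᴴ) - g (0, h) := by rw [← map_sub]; simp
    have e2 : g (0, -(hᴴ - h)) = -g (0, hᴴ - h) := by rw [← map_neg]; simp
    linarith
  obtain ⟨Q, hQdef⟩ : ∃ Q : Matrix (Fin n) (Fin n) ℂ, ∀ i j, Q i j = p (Matrix.single i j 1) :=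
    ⟨Matrix.of fun i j => p (Matrix.single i j 1), fun _ _ => rfl⟩
  have hQ : ∀ h, p h = ∑ i, ∑ j, h i j * Q i j := by
    intro h
    rw [map_eq_sum_single]
    refine Finset.sum_congr rfl fun i _ => Finset.sum_congr rfl fun j _ => ?_
    rw [hQdef, ← smul_eq_mul, ← map_smul, Matrix.smul_single, smul_eq_mul, mul_one]
  have hpη : ∀ (m : ℕ) (η : Fin m → Fin n → ℂ),
      g (0, (Matrix.of fun i k => star (η k i)) * (Matrix.of fun i k => star (η k i))ᴴ) =
        ∑ k, (star (η k) ⬝ᵥ Q *ᵥ η k).re := by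
    intro m η
    rw [← hp, hQ, ← Complex.re_sum]
    congr 1
    simp only [Matrix.mul_apply, Matrix.of_apply, Matrix.conjTranspose_apply, star_star,
      dotProduct, Matrix.mulVec, Finset.mul_sum, Finset.sum_mul, Pi.star_apply]
    symm
    rw [Finset.sum_comm]
    refine Finset.sum_congr rfl fun i _ => ?_
    rw [Finset.sum_comm]
    refine Finset.sum_congr rfl fun j _ => Finset.sum_congr rfl fun k _ => ?_
    ring
  have hSη : ∀ (m : ℕ) (η : Fin m → Fin n → ℂ), 0 ≤ ∑ k, (star (η k) ⬝ᵥ Q *ᵥ η k).re := by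
    intro m η
    rw [← hpη]
    refine hpos _ fun v => ?_
    rw [star_dotProduct_mul_conjTranspose_mulVec, Complex.ofReal_re]
    positivity
  have hQherm : Q.IsHermitian := by
    ext i j
    have e : (Matrix.single i j (1 : ℂ)) = (Matrix.single j i (1 : ℂ))ᴴ := by simp
    rw [Matrix.conjTranspose_apply, hQdef, hQdef]
    apply Complex.ext
    · rw [Complex.star_def, Complex.conj_re, hp, hp, e, hherm]
    -- The imaginary part is read off at `I • E_ij`, whose adjoint is `-I • E_ji`; this produces the
    -- conjugate sign.
    · rw [Complex.star_def, Complex.conj_im, hpi, hpi, e, ← hherm (Complex.I • _),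
        Matrix.conjTranspose_smul]
      have : g (0, star Complex.I • (Matrix.single j i (1 : ℂ))ᴴ) =
          -g (0, Complex.I • (Matrix.single j i (1 : ℂ))ᴴ) := by
        rw [← map_neg]; simp
      rw [this, neg_neg]
  have hunit : ∀ (m : ℕ) (x : Matrix (Fin m) (Fin m) X) (η : Fin m → Fin n → ℂ), W m x ≤ 1 →
      ‖∑ k, ∑ l, star (η k) ⬝ᵥ (Matrix.of fun i j => f (Matrix.single i j (x k l))) *ᵥ η l‖ ≤
        ∑ k, (star (η k) ⬝ᵥ Q *ᵥ η k).re := by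
    intro m x η hx
    rw [← map_scalarMulMul_conj, ← hpη]
    set α : Matrix (Fin n) (Fin m) ℂ := Matrix.of fun i k => star (η k i)
    -- The cone bounds only real parts; a unimodular `c`, which leaves `W x` unchanged, upgrades
    -- this to the modulus.
    obtain ⟨c, hc, hcf⟩ := RCLike.exists_norm_eq_mul_self (f (scalarMulMul α x αᴴ))
    have h1 : 0 ≤ g (scalarMulMul α (c • x) αᴴ, α * αᴴ) := by
      refine hg _ ⟨m, α, c • x, ?_, rfl, fun v => ?_⟩
      · rwa [(hW.isNorm m).smul_eq, hc, one_mul]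
      · rw [star_dotProduct_mul_conjTranspose_mulVec, Complex.ofReal_re]
    have h2 : g (scalarMulMul α (c • x) αᴴ, α * αᴴ) =
        g (scalarMulMul α (c • x) αᴴ, 0) + g (0, α * αᴴ) := by rw [← map_add]; simp
    have h3 : ‖f (scalarMulMul α x αᴴ)‖ = -g (scalarMulMul α (c • x) αᴴ, 0) := by
      rw [← hf, scalarMulMul_smul, map_smul, smul_eq_mul, ← hcf]
      simp
    linarith
  refine ⟨f, Q, ?_, ?_, ?_, ?_⟩
  · rw [hf, hg₀, neg_neg]
  · refine Matrix.PosSemidef.of_dotProduct_mulVec_nonneg hQherm fun v => ?_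
    rw [Complex.nonneg_iff]
    refine ⟨by simpa using hSη 1 fun _ => v, ?_⟩
    exact (hQherm.im_star_dotProduct_mulVec_self v).symm
  · have : p 1 = Q.trace := by
      rw [hQ]
      simp [Matrix.one_apply, Matrix.trace]
    rw [← this, hp, hg₁]
  · intro m x η
    have hx := (hW.isNorm m).nonneg x
    rcases hx.eq_or_lt with h0 | h0
    · rw [(hW.isNorm m).eq_zero x h0.symm, (hW.isNorm m).map_zero]
      simp [Matrix.mulVec, dotProduct]
    · have h := hunit m ((W m x : ℂ)⁻¹ • x) η (by
        rw [(hW.isNorm m).smul_eq, norm_inv, Complex.norm_real, Real.norm_of_nonneg hx,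
          inv_mul_cancel₀ h0.ne'])
      rw [← map_scalarMulMul_conj, scalarMulMul_smul, map_smul, norm_smul, norm_inv,
        Complex.norm_real, Real.norm_of_nonneg hx, inv_mul_le_iff₀ h0, map_scalarMulMul_conj] at h
      exact h

end Representation

/-! ### Finite-dimensional representations and their sum -/

section Assembly

open scoped Matrix MatrixOrder ComplexOrder

variable {X : Type*} [AddCommGroup X] [Module ℂ X] {n : ℕ}

theorem Matrix.PosDef.exists_conjTranspose_mul_self_eq {A : Matrix (Fin n) (Fin n) ℂ}
    (hA : A.PosDef) : ∃ S T : Matrix (Fin n) (Fin n) ℂ, Sᴴ * S = A ∧ S * T = 1 ∧ T * S = 1 := by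
  obtain ⟨S, hS⟩ := CStarAlgebra.nonneg_iff_eq_star_mul_self.mp hA.posSemidef.nonneg
  have hu : IsUnit S.det := by
    have h := (Matrix.isUnit_iff_isUnit_det _).mp hA.isUnit
    rw [hS, Matrix.det_mul] at h
    exact isUnit_of_mul_isUnit_right h
  exact ⟨S, S⁻¹, hS.symm, Matrix.mul_nonsing_inv S hu, Matrix.nonsing_inv_mul S hu⟩

/-- The linear map `y ↦ [f (E_ij ⊗ y)]`. -/
def entryMap (f : Matrix (Fin n) (Fin n) X →ₗ[ℂ] ℂ) : X →ₗ[ℂ] Matrix (Fin n) (Fin n) ℂ where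
  toFun y := Matrix.of fun i j => f (Matrix.single i j y)
  map_add' y z := by
    ext i j
    simp [Matrix.single_add]
  map_smul' c y := by
    ext i j
    simp [← Matrix.smul_single]

theorem sum_norm_sq_mulVec_eq (S : Matrix (Fin n) (Fin n) ℂ) (v : Fin n → ℂ) :
    ∑ i, ‖(S *ᵥ v) i‖ ^ 2 = (star v ⬝ᵥ (Sᴴ * S) *ᵥ v).re := by
  have h := star_dotProduct_mul_conjTranspose_mulVec Sᴴ v
  rw [Matrix.conjTranspose_conjTranspose] at h
  rw [h, Complex.ofReal_re]

variable {W : ∀ n : ℕ, Matrix (Fin n) (Fin n) X → ℝ}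

/-- `Q` may be singular, so it is perturbed to the invertible `Q + ε = S*S`; the slack in `c < W n
x₀` pays for the extra trace `nε`. -/
theorem exists_representation_of_lt (hW : IsNumericalRadiusOperatorSpace W)
    (x₀ : Matrix (Fin n) (Fin n) X) {c : ℝ} (hc : c < W n x₀) :
    ∃ Φ : X →ₗ[ℂ] (EuclideanSpace ℂ (Fin n) →L[ℂ] EuclideanSpace ℂ (Fin n)),
      (∀ (m : ℕ) (x : Matrix (Fin m) (Fin m) X),
        matrixNumericalRadius (EuclideanSpace ℂ (Fin n)) m (x.map Φ) ≤ W m x) ∧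
      c ≤ matrixNumericalRadius (EuclideanSpace ℂ (Fin n)) n (x₀.map Φ) := by
  rcases lt_or_ge c 0 with hc0 | hc0
  · refine ⟨0, fun m x => ?_, hc0.le.trans (numericalRadius_nonneg _)⟩
    refine matrixNumericalRadius_le ((hW.isNorm m).nonneg x) fun ξ => ?_
    have := mul_nonneg ((hW.isNorm m).nonneg x)
      (Finset.sum_nonneg fun k (_ : k ∈ Finset.univ) => sq_nonneg ‖ξ k‖)
    simpa using this
  have hx₀ : x₀ ≠ 0 := by
    rintro rfl
    rw [(hW.isNorm n).map_zero] at hc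
    exact absurd hc hc0.not_gt
  obtain ⟨f, Q, hf, hQ, htr, hle⟩ := exists_form_domination hW hx₀
  obtain ⟨ε, hε, hεc⟩ : ∃ ε : ℝ, 0 < ε ∧ c * (1 + n * ε) ≤ W n x₀ := by
    have hd : 0 < c * n + 1 := by positivity
    -- The `+ 1` covers `c = 0`.
    refine ⟨(W n x₀ - c) / (c * n + 1), div_pos (sub_pos.mpr hc) hd, ?_⟩
    have : c * n * ((W n x₀ - c) / (c * n + 1)) ≤ W n x₀ - c := by
      rw [← mul_div_assoc, div_le_iff₀ hd]
      nlinarith [sub_pos.mpr hc]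
    linarith
  have hQε : (Q + (ε : ℂ) • (1 : Matrix (Fin n) (Fin n) ℂ)).PosDef :=
    Matrix.PosDef.posSemidef_add hQ (Matrix.PosDef.one.smul (by exact_mod_cast hε))
  obtain ⟨S, T, hS, hST, hTS⟩ := hQε.exists_conjTranspose_mul_self_eq
  let Φ : X →ₗ[ℂ] (EuclideanSpace ℂ (Fin n) →L[ℂ] EuclideanSpace ℂ (Fin n)) :=
    (Matrix.toEuclideanCLM (n := Fin n) (𝕜 := ℂ)).toAlgEquiv.toLinearMap ∘ₗ
      (LinearMap.mulRight ℂ T ∘ₗ LinearMap.mulLeft ℂ Tᴴ) ∘ₗ entryMap f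
  have hΦ : ∀ (y : X) (u v : EuclideanSpace ℂ (Fin n)), inner ℂ u (Φ y v) =
      star (T *ᵥ u.ofLp) ⬝ᵥ (Matrix.of fun i j => f (Matrix.single i j y)) *ᵥ (T *ᵥ v.ofLp) := by
    intro y u v
    have h1 : Φ y v = WithLp.toLp 2 ((Tᴴ * entryMap f y * T) *ᵥ v.ofLp) := by
      rw [← Matrix.toEuclideanCLM_toLp]
      rfl
    rw [h1, EuclideanSpace.inner_eq_star_dotProduct, dotProduct_comm, Matrix.star_mulVec,
      ← Matrix.dotProduct_mulVec, Matrix.mulVec_mulVec, Matrix.mulVec_mulVec]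
    rfl
  have hnorm : ∀ u : EuclideanSpace ℂ (Fin n), ‖u‖ ^ 2 =
      (star (T *ᵥ u.ofLp) ⬝ᵥ Q *ᵥ (T *ᵥ u.ofLp)).re + ε * ∑ i, ‖(T *ᵥ u.ofLp) i‖ ^ 2 := by
    intro u
    have h1 : S *ᵥ (T *ᵥ u.ofLp) = u.ofLp := by
      rw [Matrix.mulVec_mulVec, hST, Matrix.one_mulVec]
    rw [EuclideanSpace.norm_sq_eq, ← re_dotProduct_real_smul_one, ← Complex.add_re,
      ← dotProduct_add, ← Matrix.add_mulVec, ← Complex.coe_smul, ← hS, ← sum_norm_sq_mulVec_eq, h1]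
  refine ⟨Φ, fun m x => ?_, ?_⟩
  · refine matrixNumericalRadius_le ((hW.isNorm m).nonneg x) fun ξ => ?_
    simp only [Matrix.map_apply, hΦ]
    refine (hle m x fun k => T *ᵥ (ξ k).ofLp).trans ?_
    refine mul_le_mul_of_nonneg_left (Finset.sum_le_sum fun k _ => ?_) ((hW.isNorm m).nonneg x)
    rw [hnorm]
    exact le_add_of_nonneg_right (mul_nonneg hε.le (Finset.sum_nonneg fun _ _ => sq_nonneg _))
  -- Since `T (S e_k) = e_k`, the form at these vectors is `∑ f(E_kl ⊗ x₀_kl) = f(x₀)`.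
  · let ξ : Fin n → EuclideanSpace ℂ (Fin n) := fun k => WithLp.toLp 2 (S *ᵥ Pi.single k 1)
    have hξ : ∀ k, T *ᵥ (ξ k).ofLp = Pi.single k 1 := by
      intro k
      rw [Matrix.mulVec_mulVec, hTS, Matrix.one_mulVec]
    have h := norm_inner_le_matrixNumericalRadius (x₀.map Φ) ξ
    have h1 : ∑ k, ∑ l, inner ℂ (ξ k) ((x₀.map Φ) k l (ξ l)) = f x₀ := by
      rw [map_eq_sum_single]
      refine Finset.sum_congr rfl fun k _ => Finset.sum_congr rfl fun l _ => ?_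
      rw [Matrix.map_apply, hΦ, hξ, hξ]
      simp
    have h2 : ∑ k, ‖ξ k‖ ^ 2 = 1 + n * ε := by
      have h3 : ∀ k, ‖ξ k‖ ^ 2 = (Q k k).re + ε := by
        intro k
        rw [hnorm, hξ, Finset.sum_eq_single k (fun i _ hi => by simp [Pi.single_eq_of_ne hi])
          (by simp)]
        simp
      simp only [h3, Finset.sum_add_distrib, ← Complex.re_sum]
      rw [← htr]
      simp [Matrix.trace]
    rw [h1, h2] at h
    have h4 : W n x₀ ≤ ‖f x₀‖ := hf ▸ Complex.re_le_norm _
    exact le_of_mul_le_mul_right (hεc.trans (h4.trans h)) (by positivity)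

end Assembly

theorem corollary2p6 {X : Type u} [AddCommGroup X] [Module ℂ X]
    (W : ∀ n : ℕ, Matrix (Fin n) (Fin n) X → ℝ) (hW : IsNumericalRadiusOperatorSpace W) :
    IsOperatorSpace (offDiagNorm W) ∧
      ∃ (H : Type u) (_ : NormedAddCommGroup H) (_ : InnerProductSpace ℂ H) (_ : CompleteSpace H)
        (Φ : X →ₗ[ℂ] (H →L[ℂ] H)),
        IsCompletelyIsometric (offDiagNorm W) (matrixOpNorm H) Φ ∧
        IsCompletelyIsometric W (matrixNumericalRadius H) Φ := by
  refine ⟨isOperatorSpace_offDiagNorm hW, ?_⟩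
  -- One summand per matrix and strict lower bound, so no supremum need be attained; indexing by
  -- `X`-data keeps `H` in `Type u`.
  let ι : Type u := Σ n : ℕ, {p : Matrix (Fin n) (Fin n) X × ℝ // p.2 < W n p.1}
  choose Φ hle hge using fun i : ι => exists_representation_of_lt hW i.2.1.1 i.2.2
  obtain ⟨Ψ, hΨ⟩ := exists_isCompletelyIsometric_lp (fun n x => (hW.isNorm n).nonneg x) Φ
    (fun i n x => hle i n x) fun n x c hc => ⟨⟨n, (x, c), hc⟩, hge ⟨n, (x, c), hc⟩⟩
  exact ⟨_, _, _, inferInstance, Ψ, hΨ.offDiagNorm, hΨ⟩
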